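/- For $m \ge 1$ let $\mathcal{J}_m$ be the set of fixed-point-free involutions of $\{1,\dots,m\}$, i.e. permutations $\pi$ with $\pi(\pi(i)) = i$ and $\pi(i)\neq i$ for all $i$. Let $\mathrm{des}(\pi) = \#\{ i \in \{1,\dots,m-1\} : \pi(i) > \pi(i+1)\}$, and put $J_m(t) = \sum_{\pi\in\mathcal{J}_m} t^{\mathrm{des}(\pi)}$. A polynomial $p(t) = a_r t^r + a_{r+1}t^{r+1} + \cdots + a_s t^s$ with $a_r, a_s \ne 0$ is called palindromic of center $m/2$ if $m = r+s$ and $a_{r+i} = a_{s-i}$ for $0 \le i \le m/2 - r$. Such a polynomial can be written uniquely as $p(t) = \sum_{k=r}^{\lfloor m/2\rfloor} \gamma_k\, t^k (1+t)^{m-2k}$, and it is called $\gamma$-positive if $\gamma_k\ge 0$ for every $k$. Theorem. For every $n \ge 9$ the polynomial $J_{2n}(t)$ is palindromic of center $n$ and $\gamma$-positive: there are (uniquely determined) integers $b_{2n,1},\dots,b_{2n,n} \ge 0$ with $$J_{2n}(t) = \sum_{k=1}^{n} b_{2n,k}\, t^k (1+t)^{2n-2k}.$$ -/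

import Mathlib

open Polynomial

/-- The set of descents of `π`: the positions `i` whose successor `i + 1` is again a position
and with `π i > π (i + 1)`. Positions and values are numbered `0, …, n - 1`. -/
def descentSet {n : ℕ} (π : Equiv.Perm (Fin n)) : Finset (Fin n) :=
  Finset.univ.filter fun i => ∃ h : (i : ℕ) + 1 < n, π ⟨(i : ℕ) + 1, h⟩ < π i

/-- The descent number of a permutation. -/
def descentNumber {n : ℕ} (π : Equiv.Perm (Fin n)) : ℕ :=
  (descentSet π).card

/-- The fixed-point-free involutions of an `n`-element set. -/
def fixedPointFreeInvolutions (n : ℕ) : Finset (Equiv.Perm (Fin n)) :=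
  Finset.univ.filter fun π => (∀ i, π (π i) = i) ∧ ∀ i, π i ≠ i

/-- The descent polynomial `J_n(t)` of the fixed-point-free involutions. -/
noncomputable def descentPolynomialJ (n : ℕ) : ℤ[X] :=
  ∑ π ∈ fixedPointFreeInvolutions n, X ^ descentNumber π

/-- `p = a_r t ^ r + ⋯ + a_s t ^ s`, with lowest exponent `r` and highest exponent `s`, is
palindromic of center `n / 2`: `r + s = n`, and `a_{r+i} = a_{s-i}` for `0 ≤ i ≤ n / 2 - r`. -/
def IsPalindromicOfCenter (p : ℤ[X]) (n : ℕ) : Prop :=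
  p.natTrailingDegree + p.natDegree = n ∧
    ∀ i : ℕ, 2 * (p.natTrailingDegree + i) ≤ n →
      p.coeff (p.natTrailingDegree + i) = p.coeff (p.natDegree - i)

/-- `p` is `γ`-positive of center `n / 2`: it is palindromic of center `n / 2`, and its
coefficients in the basis `t ^ k (1 + t) ^ (n - 2 k)`, `r ≤ k ≤ ⌊n / 2⌋`, are nonnegative,
where `r` is the lowest exponent of `p`. (These coefficients are unique, since the lowest
exponents of the basis elements are distinct.) -/
def IsGammaPositive (p : ℤ[X]) (n : ℕ) : Prop :=
  IsPalindromicOfCenter p n ∧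
    ∃ γ : ℕ → ℤ,
      p = ∑ k ∈ Finset.Icc p.natTrailingDegree (n / 2),
        C (γ k) * X ^ k * (1 + X) ^ (n - 2 * k) ∧
      ∀ k ∈ Finset.Icc p.natTrailingDegree (n / 2), 0 ≤ γ k

/-!
The proof goes through an explicit generating function. Call a word `a : Fin m → Fin r` compatible
with a permutation `π` if it is weakly increasing and `π` is increasing on each of its level sets,
i.e. if `a` increases strictly across each descent of `π`. Adding to `a i` the number of
non-descents before `i` turns these words into strictly increasing ones, so there are
`(r + m - 1 - des π).choose m` of them (`card_isCompatible`). On the other hand, a fixed-point-free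
involution `π` of `2 n` points with a compatible word is recovered from the multiset of the `n`
unordered pairs `{a i, a (π i)}`, and every multiset of `n` two-element subsets of `Fin r` occurs
(the case of cycle type `2 ^ n` of the Gessel-Reutenauer bijection, `card_compatiblePairs`). Hence
`∑ π, (r + 2 n - 1 - des π).choose (2 n) = multichoose (r.choose 2) n` for all `r` if `n ≥ 1`,
which says that the series `F n = ∑ r, pairWeight n r * X ^ r` satisfies
`(1 - X) ^ (2 n + 1) * F n = 2 ^ n n! * X * J_{2n}(X)`.

Since `pairWeight (n + 1) r = (r (r - 1) + 2 n) * pairWeight n r`, one has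
`F (n + 1) = X² F n'' + 2 n F n`. In the basis `X ^ k (1 + X) ^ (2 n - 2 k)` this becomes a
three-term recurrence for the integers `gammaNumerator n k`, which are `2 ^ n n!` times the
γ-coefficients of `J_{2n}` (`C_mul_descentPolynomialJ`); that they are divisible by `2 ^ n n!`
follows from the unitriangularity of the basis.

The recurrence has nonnegative coefficients except in the top case `k = n + 1`, where
`gammaNumerator n n` enters with the factor `-(6 n - 2)` and `gammaNumerator n (n - 1)` with `8`.
With `x`, `y`, `z` the three topmost numbers for `n`, the inequalities `n x ≤ y` and `3 n y ≤ 20 z`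
hold for `n = 10` and are inherited from `n` to `n + 1`, and they make the top number nonnegative
(`gammaNumerator_nonneg_of_ratio`). The numbers for `n = 9` and `n = 10` are evaluated.
-/

/-! ### Two counts -/

theorem Finset.card_piAntidiag_eq_multichoose {ι : Type*} [DecidableEq ι] [Fintype ι]
    (s : Finset ι) (n : ℕ) : (Finset.piAntidiag s n).card = s.card.multichoose n := by
  rw [← Finset.card_finsuppAntidiag_nat_eq_multichoose]
  refine Finset.card_bij' (fun f _ => Finsupp.equivFunOnFinite.symm f) (fun f _ => ⇑f) ?_ ?_ ?_ ?_
  · intro f hf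
    rw [Finset.mem_piAntidiag] at hf
    rw [Finset.mem_finsuppAntidiag]
    exact ⟨hf.1, fun i hi => hf.2 i (by simpa using hi)⟩
  · intro f hf
    rw [Finset.mem_finsuppAntidiag] at hf
    rw [Finset.mem_piAntidiag]
    exact ⟨hf.1, fun i hi => hf.2 (by simpa using hi)⟩
  · intro f _; ext; simp
  · intro f _; ext; simp

theorem card_strictMono_fin (k N : ℕ) :
    Fintype.card {c : Fin k → Fin N // StrictMono c} = N.choose k := by
  classical
  rw [Fintype.card_subtype, ← Finset.card_fin N, ← Finset.card_powersetCard, Finset.card_fin N]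
  refine Finset.card_bij (fun c _ => Finset.univ.image c) ?_ ?_ ?_
  · intro c hc
    rw [Finset.mem_filter] at hc
    rw [Finset.mem_powersetCard]
    exact ⟨Finset.subset_univ _, by rw [Finset.card_image_of_injective _ hc.2.injective]; simp⟩
  · intro c hc d hd h
    rw [Finset.mem_filter] at hc hd
    have h' := congrArg (fun s : Finset (Fin N) => (s : Set (Fin N))) h
    simp only [Finset.coe_image, Finset.coe_univ, Set.image_univ] at h'
    exact (hc.2.range_inj hd.2).1 h'
  · intro s hs
    rw [Finset.mem_powersetCard] at hs
    exact ⟨s.orderEmbOfFin hs.2, by simpa using (s.orderEmbOfFin hs.2).strictMono, by simp⟩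

/-! ### Words compatible with a permutation -/

/-- The number of non-descents of `π` among the positions before `i`. -/
def nonDescentsBefore {m : ℕ} (π : Equiv.Perm (Fin (m + 1))) (i : Fin (m + 1)) : ℕ :=
  (Finset.univ.filter fun j => j < i ∧ j ∉ descentSet π).card

theorem castSucc_mem_descentSet {m : ℕ} (π : Equiv.Perm (Fin (m + 1))) (i : Fin m) :
    i.castSucc ∈ descentSet π ↔ π i.succ < π i.castSucc := by
  simp only [descentSet, Finset.mem_filter, Finset.mem_univ, true_and]
  exact ⟨fun ⟨_, h⟩ => h, fun h => ⟨by simp, h⟩⟩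

theorem last_notMem_descentSet {m : ℕ} (π : Equiv.Perm (Fin (m + 1))) :
    Fin.last m ∉ descentSet π := by
  simp [descentSet]

theorem nonDescentsBefore_succ {m : ℕ} (π : Equiv.Perm (Fin (m + 1))) (i : Fin m) :
    nonDescentsBefore π i.succ =
      nonDescentsBefore π i.castSucc + if i.castSucc ∈ descentSet π then 0 else 1 := by
  unfold nonDescentsBefore
  split_ifs with h
  · rw [add_zero]
    refine congrArg Finset.card ?_
    ext j
    simp only [Finset.mem_filter, Finset.mem_univ, true_and]
    refine and_congr_left fun hj => ?_
    have h3 : j ≠ i.castSucc := fun h3 => hj (h3 ▸ h)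
    rw [Fin.lt_def, Fin.lt_def, Fin.val_succ, Fin.val_castSucc]
    rw [Ne, Fin.ext_iff, Fin.val_castSucc] at h3
    omega
  · rw [← Finset.card_insert_of_notMem (a := i.castSucc) (by simp)]
    refine congrArg Finset.card ?_
    ext j
    simp only [Finset.mem_filter, Finset.mem_univ, true_and, Finset.mem_insert]
    constructor
    · rintro ⟨h1, h2⟩
      by_cases h3 : j = i.castSucc
      · exact Or.inl h3
      · refine Or.inr ⟨?_, h2⟩
        rw [Fin.lt_def, Fin.val_succ] at h1
        rw [Fin.ext_iff, Fin.val_castSucc] at h3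
        rw [Fin.lt_def, Fin.val_castSucc]
        omega
    · rintro (rfl | ⟨h1, h2⟩)
      · exact ⟨by simp, h⟩
      · exact ⟨h1.trans (by simp), h2⟩

theorem nonDescentsBefore_zero {m : ℕ} (π : Equiv.Perm (Fin (m + 1))) :
    nonDescentsBefore π 0 = 0 := by
  simp [nonDescentsBefore]

theorem monotone_nonDescentsBefore {m : ℕ} (π : Equiv.Perm (Fin (m + 1))) :
    Monotone (nonDescentsBefore π) := by
  intro i j hij
  refine Finset.card_le_card fun k hk => ?_
  simp at hk ⊢; exact ⟨hk.1.trans_le hij, hk.2⟩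

theorem nonDescentsBefore_last_add {m : ℕ} (π : Equiv.Perm (Fin (m + 1))) :
    nonDescentsBefore π (Fin.last m) + descentNumber π = m := by
  have h : (Finset.univ.filter fun j => j < Fin.last m ∧ j ∉ descentSet π) ∪ descentSet π
      = Finset.univ.erase (Fin.last m) := by
    ext j
    simp only [Finset.mem_union, Finset.mem_filter, Finset.mem_univ, true_and, Finset.mem_erase,
      and_true, Fin.lt_last_iff_ne_last]
    by_cases hj : j ∈ descentSet π
    · simpa [hj] using fun h : j = Fin.last m => last_notMem_descentSet π (h ▸ hj)
    · simp [hj]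
  have h2 := congrArg Finset.card h
  rw [Finset.card_union_of_disjoint] at h2
  · simpa [nonDescentsBefore, descentNumber] using h2
  · rw [Finset.disjoint_left]
    intro j hj; simp at hj; exact hj.2

theorem descentNumber_le {m : ℕ} (π : Equiv.Perm (Fin (m + 1))) : descentNumber π ≤ m :=
  le_of_add_le_right (nonDescentsBefore_last_add π).le

/-- A word `a` is compatible with `π` if the pairs `(a i, π i)` increase strictly in the
lexicographic order; that is, `a` is weakly increasing and `π` is increasing where `a` is
constant. -/
def IsCompatible {m : ℕ} {α : Type*} [LinearOrder α] (π : Equiv.Perm (Fin m)) (a : Fin m → α) :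
    Prop :=
  ∀ ⦃i j : Fin m⦄, i < j → a i < a j ∨ (a i = a j ∧ π i < π j)

/-- From `i` to `i + 1` the count of non-descents grows by one exactly where `a` may stay
constant, so adding it makes all the conditions on consecutive letters strict. -/
theorem isCompatible_iff_strictMono {m r : ℕ} (π : Equiv.Perm (Fin (m + 1)))
    (a : Fin (m + 1) → Fin r) :
    IsCompatible π a ↔ StrictMono fun i => (a i : ℕ) + nonDescentsBefore π i := by
  have h1 : IsCompatible π a ↔ StrictMono fun i => toLex (a i, π i) := by
    simp [IsCompatible, StrictMono, Prod.Lex.lt_iff]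
  rw [h1, Fin.strictMono_iff_lt_succ, Fin.strictMono_iff_lt_succ]
  refine forall_congr' fun i => ?_
  rw [nonDescentsBefore_succ, Prod.Lex.lt_iff]
  have h2 : π i.castSucc ≠ π i.succ := by
    simp [Fin.ext_iff]
  rcases lt_or_gt_of_ne h2 with h | h
  · have h3 : i.castSucc ∉ descentSet π := by
      rw [castSucc_mem_descentSet]; exact h.not_gt
    simp [h3, h, Fin.ext_iff]; omega
  · have h3 : i.castSucc ∈ descentSet π := by
      rw [castSucc_mem_descentSet]; exact h
    simp [h3, h.not_gt]

open Classical in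
/-- For a permutation of `m + 1` points, `r + m - descentNumber π` is not truncated. -/
theorem card_isCompatible {m : ℕ} (π : Equiv.Perm (Fin (m + 1))) (r : ℕ) :
    (Finset.univ.filter fun a : Fin (m + 1) → Fin r => IsCompatible π a).card =
      (r + m - descentNumber π).choose (m + 1) := by
  have hN : r + m - descentNumber π = r + nonDescentsBefore π (Fin.last m) := by
    have := nonDescentsBefore_last_add π
    omega
  rw [hN, ← card_strictMono_fin, Fintype.card_subtype]
  have hlast : ∀ i, nonDescentsBefore π i ≤ nonDescentsBefore π (Fin.last m) :=
    fun i => monotone_nonDescentsBefore π (Fin.le_last i)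
  refine Finset.card_bij
    (fun a _ i => ⟨(a i : ℕ) + nonDescentsBefore π i, add_lt_add_of_lt_of_le (a i).2 (hlast i)⟩)
    ?_ ?_ ?_
  · intro a ha
    rw [Finset.mem_filter, isCompatible_iff_strictMono] at ha
    exact Finset.mem_filter.2 ⟨Finset.mem_univ _, ha.2⟩
  · intro a _ b _ h
    ext i
    simpa using congrFun h i
  · intro c hc
    simp only [Finset.mem_filter, Finset.mem_univ, true_and] at hc
    -- The count of non-descents grows by at most one per step, and `c` by at least one.
    have hmono : Monotone fun i => ((c i : ℕ) : ℤ) - nonDescentsBefore π i := by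
      rw [Fin.monotone_iff_le_succ]
      intro i
      have h1 : (c i.castSucc : ℕ) < c i.succ := hc Fin.castSucc_lt_succ
      have h2 := nonDescentsBefore_succ π i
      split_ifs at h2 <;> omega
    have hge : ∀ i, nonDescentsBefore π i ≤ c i := by
      intro i
      have := hmono (Fin.zero_le i)
      simp only [nonDescentsBefore_zero] at this
      omega
    have hlt : ∀ i, (c i : ℕ) - nonDescentsBefore π i < r := by
      intro i
      have h1 : ((c i : ℕ) : ℤ) - _ ≤ _ - _ := hmono (Fin.le_last i)
      have h2 := (c (Fin.last m)).2
      have h3 := hge i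
      omega
    refine ⟨fun i => ⟨c i - nonDescentsBefore π i, hlt i⟩, ?_, ?_⟩
    · simp only [Finset.mem_filter, Finset.mem_univ, true_and, isCompatible_iff_strictMono]
      intro i j hij
      simpa [Nat.sub_add_cancel (hge _)] using hc hij
    · funext i
      ext
      simp [Nat.sub_add_cancel (hge _)]

/-! ### Compatible words of fixed-point-free involutions -/

section Words
variable {α : Type*} [LinearOrder α]

theorem IsCompatible.monotone {m : ℕ} {π : Equiv.Perm (Fin m)} {a : Fin m → α}
    (h : IsCompatible π a) : Monotone a := by
  refine monotone_iff_forall_lt.2 fun i j hij => ?_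
  rcases h hij with h | h
  · exact h.le
  · exact h.1.le

/-- A weakly increasing word is determined by how often each letter occurs in it. -/
theorem Monotone.eq_of_card_fiber_eq {m : ℕ} {f g : Fin m → α} (hf : Monotone f)
    (hg : Monotone g)
    (h : ∀ x, (Finset.univ.filter fun i => f i = x).card =
      (Finset.univ.filter fun i => g i = x).card) : f = g := by
  have key : ∀ f : Fin m → α, ∀ x,
      (List.ofFn f).count x = (Finset.univ.filter fun i => f i = x).card := by
    intro f x
    rw [List.ofFn_eq_map, List.count, List.countP_map, Finset.card_filter,
      ← List.sum_ofFn, List.ofFn_eq_map, List.countP_eq_length_filter]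
    induction (List.finRange m) with
    | nil => simp
    | cons a l ih => by_cases h : f a = x <;> simp [h, ih, add_comm]
  apply List.ofFn_injective
  refine List.Perm.eq_of_pairwise' (r := (· ≤ ·)) ?_ ?_ ?_
  · exact hf.sortedLE_ofFn.pairwise
  · exact hg.sortedLE_ofFn.pairwise
  · rw [List.perm_iff_count]
    intro x
    rw [key, key, h]

/-- If `a i = a (π i)`, then `π` preserves the order of `i` and `π i`, but it exchanges them. -/
theorem IsCompatible.ne_apply {m : ℕ} {π : Equiv.Perm (Fin m)} {a : Fin m → α}
    (h : IsCompatible π a) (hπ : ∀ i, π (π i) = i) (hπ' : ∀ i, π i ≠ i) (i : Fin m) :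
    a i ≠ a (π i) := by
  intro hi
  rcases lt_or_gt_of_ne (hπ' i) with hlt | hlt
  · have := ((h hlt).resolve_left hi.symm.not_lt).2
    rw [hπ] at this
    exact lt_asymm this hlt
  · have := ((h hlt).resolve_left hi.not_lt).2
    rw [hπ] at this
    exact lt_asymm this hlt

theorem IsCompatible.monotone_toLex {m : ℕ} {π : Equiv.Perm (Fin m)} {a : Fin m → α}
    (h : IsCompatible π a) : Monotone fun i => toLex (a i, a (π i)) := by
  refine monotone_iff_forall_lt.2 fun i j hij => ?_
  rw [Prod.Lex.le_iff]
  rcases h hij with h' | h'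
  · exact Or.inl h'
  · exact Or.inr ⟨h'.1, h.monotone h'.2.le⟩

/-- An involution `π` with compatible word `a` is determined by `a` and `a ∘ π`: if `ρ` has the
same data, then `ρ * π` preserves `a` and is increasing, hence it is the identity. -/
theorem IsCompatible.perm_eq {m : ℕ} {π ρ : Equiv.Perm (Fin m)} {a : Fin m → α}
    (hπa : IsCompatible π a) (hρa : IsCompatible ρ a) (hπ : ∀ i, π (π i) = i)
    (hρ : ∀ i, ρ (ρ i) = i) (h : ∀ i, a (π i) = a (ρ i)) : π = ρ := by
  have hσ : ∀ i, a (ρ (π i)) = a i := fun i => by rw [← h, hπ]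
  have hmono : Monotone (ρ * π) := by
    refine monotone_iff_forall_lt.2 fun i j hij => ?_
    rcases hπa hij with h' | h'
    · refine (hπa.monotone.reflect_lt ?_).le
      rwa [Equiv.Perm.mul_apply, Equiv.Perm.mul_apply, hσ, hσ]
    · -- If `ρ` reversed `π i < π j`, then applying `ρ` once more would reverse it again.
      by_contra! hlt
      rw [Equiv.Perm.mul_apply, Equiv.Perm.mul_apply] at hlt
      have := (hρa hlt).resolve_left (by rw [hσ, hσ, h'.1]; exact lt_irrefl _)
      rw [hρ, hρ] at this
      exact lt_asymm this.2 h'.2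
  have h1 : ρ * π = 1 := (Equiv.Perm.monotone_iff _).1 hmono
  ext i
  have h2 : ρ (π i) = i := by rw [← Equiv.Perm.mul_apply, h1]; rfl
  rw [← h2, hρ, h2]

/-- The number of positions `i` such that `(a i, a (π i))` is the pair `p`. -/
def pairCount {m : ℕ} (π : Equiv.Perm (Fin m)) (a : Fin m → α) (p : α × α) : ℕ :=
  (Finset.univ.filter fun i => a i = p.1 ∧ a (π i) = p.2).card

theorem pairCount_swap {m : ℕ} {π : Equiv.Perm (Fin m)} (hπ : ∀ i, π (π i) = i) (a : Fin m → α)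
    (p : α × α) : pairCount π a p.swap = pairCount π a p := by
  refine Finset.card_nbij' π π ?_ ?_ ?_ ?_
  · intro i; simp [hπ]; tauto
  · intro i; simp [hπ]; tauto
  · intro i _; exact hπ i
  · intro i _; exact hπ i

end Words

section Count
variable {α : Type*} [LinearOrder α] [Fintype α]

theorem mem_fixedPointFreeInvolutions {n : ℕ} {π : Equiv.Perm (Fin n)} :
    π ∈ fixedPointFreeInvolutions n ↔ (∀ i, π (π i) = i) ∧ ∀ i, π i ≠ i := by
  simp [fixedPointFreeInvolutions]

open Classical in
/-- The pairs of a fixed-point-free involution of `Fin n` and a word in the alphabet `α`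
compatible with it. -/
noncomputable def compatiblePairs (α : Type*) [LinearOrder α] [Fintype α] (n : ℕ) :
    Finset (Equiv.Perm (Fin n) × (Fin n → α)) :=
  (fixedPointFreeInvolutions n ×ˢ Finset.univ).filter fun q => IsCompatible q.1 q.2

theorem mem_compatiblePairs {n : ℕ} {q : Equiv.Perm (Fin n) × (Fin n → α)} :
    q ∈ compatiblePairs α n ↔
      (∀ i, q.1 (q.1 i) = i) ∧ (∀ i, q.1 i ≠ i) ∧ IsCompatible q.1 q.2 := by
  simp [compatiblePairs, mem_fixedPointFreeInvolutions, and_assoc]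

/-- Exchanging `i` and `π i` shows that the pairs `p.1 < p.2` make up half of all positions. -/
theorem sum_pairCount_lt {n : ℕ} {q : Equiv.Perm (Fin (2 * n)) × (Fin (2 * n) → α)}
    (hq : q ∈ compatiblePairs α (2 * n)) :
    ∑ p ∈ Finset.univ.filter (fun p : α × α => p.1 < p.2), pairCount q.1 q.2 p = n := by
  obtain ⟨h1, h2, h3⟩ := mem_compatiblePairs.1 hq
  have hu : ∑ p : α × α, pairCount q.1 q.2 p = 2 * n := by
    have := Finset.card_eq_sum_card_fiberwise (s := (Finset.univ : Finset (Fin (2 * n))))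
      (t := (Finset.univ : Finset (α × α))) (f := fun i => (q.2 i, q.2 (q.1 i)))
      (fun _ _ => Finset.mem_univ _)
    simp only [Finset.card_univ, Fintype.card_fin] at this
    refine Eq.trans ?_ this.symm
    simp [pairCount, Prod.ext_iff]
  have hd : ∀ x : α, pairCount q.1 q.2 (x, x) = 0 := by
    intro x
    rw [pairCount, Finset.card_eq_zero, Finset.filter_eq_empty_iff]
    rintro i - ⟨h, h'⟩
    exact h3.ne_apply h1 h2 i (h.trans h'.symm)
  have hs : ∑ p ∈ Finset.univ.filter (fun p : α × α => ¬ p.1 < p.2), pairCount q.1 q.2 p =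
      ∑ p ∈ Finset.univ.filter (fun p : α × α => p.1 < p.2), pairCount q.1 q.2 p := by
    rw [← Finset.sum_filter_of_ne (p := fun p : α × α => p.2 < p.1)]
    · refine Finset.sum_nbij' Prod.swap Prod.swap ?_ ?_ ?_ ?_ ?_
      · intro p; simp
      · intro p; simpa using fun h => ⟨h.le, h⟩
      · simp
      · simp
      · intro p _; rw [pairCount_swap h1]
    · intro p hp hne
      refine lt_of_le_of_ne (by simpa using hp) fun h => hne ?_
      obtain ⟨x, y⟩ := p
      dsimp only at h
      rw [h, hd]
  have := Finset.sum_filter_add_sum_filter_not Finset.univ (fun p : α × α => p.1 < p.2)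
    (pairCount q.1 q.2)
  omega

/-- The word `i ↦ (a i, a (π i))` is lexicographically increasing, so it is recovered from the
numbers of occurrences of its letters, and by symmetry the letters `p.1 < p.2` suffice. -/
theorem compatiblePairs_injOn {n : ℕ} {q q' : Equiv.Perm (Fin n) × (Fin n → α)}
    (hq : q ∈ compatiblePairs α n) (hq' : q' ∈ compatiblePairs α n)
    (h : ∀ p : α × α, p.1 < p.2 → pairCount q.1 q.2 p = pairCount q'.1 q'.2 p) : q = q' := by
  obtain ⟨h1, h2, h3⟩ := mem_compatiblePairs.1 hq
  obtain ⟨h1', h2', h3'⟩ := mem_compatiblePairs.1 hq'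
  have hall : ∀ p : α × α, pairCount q.1 q.2 p = pairCount q'.1 q'.2 p := by
    intro p
    rcases lt_trichotomy p.1 p.2 with hp | hp | hp
    · exact h p hp
    · rw [pairCount, pairCount, Finset.filter_eq_empty_iff.2, Finset.filter_eq_empty_iff.2]
      · rintro i - ⟨h, h'⟩
        exact h3'.ne_apply h1' h2' i (h.trans (hp.trans h'.symm))
      · rintro i - ⟨h, h'⟩
        exact h3.ne_apply h1 h2 i (h.trans (hp.trans h'.symm))
    · rw [← pairCount_swap h1, ← pairCount_swap h1', h p.swap hp]
  have hw : (fun i => toLex (q.2 i, q.2 (q.1 i))) = fun i => toLex (q'.2 i, q'.2 (q'.1 i)) := by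
    refine h3.monotone_toLex.eq_of_card_fiber_eq h3'.monotone_toLex fun x => ?_
    have h4 : ∀ (r : Equiv.Perm (Fin n) × (Fin n → α)) (i : Fin n),
        toLex (r.2 i, r.2 (r.1 i)) = x ↔ r.2 i = (ofLex x).1 ∧ r.2 (r.1 i) = (ofLex x).2 :=
      fun r i => Prod.ext_iff (x := (r.2 i, r.2 (r.1 i))) (y := ofLex x)
    simp only [h4]
    exact hall (ofLex x)
  have ha : q.2 = q'.2 := by
    funext i
    exact congrArg (fun z => (ofLex z).1) (congrFun hw i)
  have hp : q.1 = q'.1 := by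
    refine h3.perm_eq (ha ▸ h3') h1 h1' fun i => ?_
    have := congrArg (fun z => (ofLex z).2) (congrFun hw i)
    simpa [ha] using this
  exact Prod.ext hp ha

/-- Every symmetric matrix of natural numbers with zero diagonal and entry sum `n` comes from an
involution with a compatible word. List the triples `(x, y, k)` with `k < N (x, y)` in
lexicographic order; `π` is the effect of `(x, y, k) ↦ (y, x, k)` on positions, and `a` reads off
the first entry. -/
theorem exists_compatiblePair {n : ℕ} {N : α × α → ℕ} (hswap : ∀ p, N p.swap = N p)
    (hdiag : ∀ x, N (x, x) = 0) (hsum : ∑ p, N p = n) :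
    ∃ q ∈ compatiblePairs α n, ∀ p, pairCount q.1 q.2 p = N p := by
  classical
  let key : α × α → ℕ → (α ×ₗ α) ×ₗ ℕ := fun p k => toLex (toLex p, k)
  let K : Finset ((α ×ₗ α) ×ₗ ℕ) :=
    Finset.univ.biUnion fun p : α × α => (Finset.range (N p)).image (key p)
  have hK : ∀ t, t ∈ K ↔ (ofLex t).2 < N (ofLex (ofLex t).1) := by
    intro t
    simp only [K, key, Finset.mem_biUnion, Finset.mem_univ, true_and, Finset.mem_image,
      Finset.mem_range]
    constructor
    · rintro ⟨p, k, hk, rfl⟩; exact hk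
    · intro h; exact ⟨_, _, h, rfl⟩
  have hcard : K.card = n := by
    rw [Finset.card_biUnion, ← hsum]
    · refine Finset.sum_congr rfl fun p _ => ?_
      rw [Finset.card_image_of_injective, Finset.card_range]
      intro k l h
      exact congrArg (fun t => (ofLex t).2) h
    · intro p _ p' _ hne
      rw [Function.onFun, Finset.disjoint_left]
      intro t ht ht'
      obtain ⟨k, -, rfl⟩ := Finset.mem_image.1 ht
      obtain ⟨l, -, h⟩ := Finset.mem_image.1 ht'
      exact hne (congrArg (fun t : (α ×ₗ α) ×ₗ ℕ => ofLex (ofLex t).1) h).symm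
  let flip : K ≃ K :=
    { toFun := fun t => ⟨key (ofLex (ofLex t.1).1).swap (ofLex t.1).2,
        (hK _).2 (by simpa [key, hswap] using (hK _).1 t.2)⟩
      invFun := fun t => ⟨key (ofLex (ofLex t.1).1).swap (ofLex t.1).2,
        (hK _).2 (by simpa [key, hswap] using (hK _).1 t.2)⟩
      left_inv := fun t => rfl
      right_inv := fun t => rfl }
  let σ : Fin n ≃o K := K.orderIsoOfFin hcard
  let π : Equiv.Perm (Fin n) := σ.toEquiv.trans (flip.trans σ.symm.toEquiv)
  let w : Fin n → α × α := fun i => ofLex (ofLex (σ i).1).1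
  have hσπ : ∀ i, σ (π i) = flip (σ i) := fun i => σ.apply_symm_apply _
  have hwπ : ∀ i, w (π i) = (w i).swap := fun i => by simp only [w, hσπ]; rfl
  have hw : ∀ i, (w i).1 ≠ (w i).2 := by
    intro i h
    have h1 := (hK _).1 (σ i).2
    have h2 : N (w i) = 0 := by rw [← hdiag (w i).2]; exact congrArg N (Prod.ext h rfl)
    change _ < N (w i) at h1
    omega
  have hlt : ∀ i j, i < j ↔ (w i).1 < (w j).1 ∨ (w i).1 = (w j).1 ∧ ((w i).2 < (w j).2 ∨
      (w i).2 = (w j).2 ∧ (ofLex (σ i).1).2 < (ofLex (σ j).1).2) := by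
    intro i j
    rw [← σ.lt_iff_lt, ← Subtype.coe_lt_coe, Prod.Lex.lt_iff, Prod.Lex.lt_iff]
    rw [← (ofLex (α := α × α)).injective.eq_iff, Prod.ext_iff]
    change ((w i).1 < (w j).1 ∨ (w i).1 = (w j).1 ∧ (w i).2 < (w j).2) ∨
      ((w i).1 = (w j).1 ∧ (w i).2 = (w j).2) ∧ _ ↔ _
    tauto
  refine ⟨(π, fun i => (w i).1), mem_compatiblePairs.2 ⟨?_, ?_, ?_⟩, ?_⟩
  · intro i
    apply σ.injective
    dsimp only
    rw [hσπ, hσπ]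
    rfl
  · intro i h
    have := hwπ i
    rw [show π i = i from h] at this
    exact hw i (congrArg Prod.fst this)
  · intro i j hij
    dsimp only
    refine ((hlt i j).1 hij).imp_right fun h => ⟨h.1, (hlt _ _).2 ?_⟩
    -- With `a i = a j` as a hypothesis, the order of `i`, `j` is that of the pairs
    -- `(second entry, k)`, and these are also the entries that `π i` and `π j` differ in.
    rw [hwπ, hwπ, hσπ, hσπ]
    simp only [Prod.fst_swap, Prod.snd_swap]
    exact h.2.imp_right fun h' => ⟨h'.1, Or.inr ⟨h.1, h'.2⟩⟩
  · intro p
    rw [pairCount, ← Finset.card_range (N p)]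
    have hp : ∀ i, i ∈ Finset.univ.filter (fun i => (w i).1 = p.1 ∧ (w (π i)).1 = p.2) ↔
        w i = p := by
      intro i
      rw [Finset.mem_filter, hwπ, Prod.fst_swap, Prod.ext_iff]
      exact and_iff_right (Finset.mem_univ _)
    refine Finset.card_bij (fun i _ => (ofLex (σ i).1).2) ?_ ?_ ?_
    · intro i hi
      rw [Finset.mem_range, ← (hp i).1 hi]
      exact (hK _).1 (σ i).2
    · intro i hi j hj h
      apply σ.injective
      apply Subtype.ext
      apply ofLex.injective
      refine Prod.ext ?_ h
      exact ((hp i).1 hi).trans ((hp j).1 hj).symm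
    · intro k hk
      have hk' : key p k ∈ K := (hK _).2 (Finset.mem_range.1 hk)
      refine ⟨σ.symm ⟨key p k, hk'⟩, (hp _).2 ?_, ?_⟩
      · simp only [w, σ.apply_symm_apply]; rfl
      · simp only [σ.apply_symm_apply]; rfl

/-- Involutions of `2 n` points with a compatible word correspond to multisets of `n` two-element
subsets of the alphabet. -/
theorem card_compatiblePairs (n : ℕ) :
    (compatiblePairs α (2 * n)).card =
      (Finset.univ.filter (fun p : α × α => p.1 < p.2)).card.multichoose n := by
  classical
  rw [← Finset.card_piAntidiag_eq_multichoose]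
  refine Finset.card_bij (fun q _ p => if p.1 < p.2 then pairCount q.1 q.2 p else 0) ?_ ?_ ?_
  · intro q hq
    rw [Finset.mem_piAntidiag]
    constructor
    · refine Eq.trans ?_ (sum_pairCount_lt hq)
      refine Finset.sum_congr rfl fun p hp => if_pos (by simpa using hp)
    · intro p hp
      simpa using (ite_ne_right_iff.1 hp).1
  · intro q hq q' hq' h
    refine compatiblePairs_injOn hq hq' fun p hp => ?_
    have := congrFun h p
    simpa [hp] using this
  · intro M hM
    rw [Finset.mem_piAntidiag] at hM
    have h0 : ∀ p : α × α, ¬ p.1 < p.2 → M p = 0 := by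
      intro p hp
      by_contra h
      exact hp (by simpa using hM.2 p h)
    have hsum : ∑ p, M p = n := by
      rw [← hM.1]
      refine (Finset.sum_subset (Finset.subset_univ _) fun p _ hp => h0 p (by simpa using hp)).symm
    obtain ⟨q, hq, h⟩ := exists_compatiblePair (n := 2 * n) (N := fun p => M p + M p.swap)
      (fun p => by simp [add_comm]) (fun x => by simp [h0]) (by
        rw [Finset.sum_add_distrib, hsum, two_mul, add_right_inj, ← hsum]
        exact Equiv.sum_comp (Equiv.prodComm α α) M)
    refine ⟨q, hq, ?_⟩
    funext p
    split_ifs with hp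
    · rw [h, h0 p.swap (by simpa using hp.le), add_zero]
    · exact (h0 p hp).symm

end Count

/-! ### The generating function -/

theorem two_mul_card_filter_lt (r : ℕ) :
    2 * (Finset.univ.filter (fun p : Fin r × Fin r => p.1 < p.2)).card = r * (r - 1) := by
  have h1 : (Finset.univ.filter (fun p : Fin r × Fin r => p.1 < p.2)).card =
      (Finset.univ.filter (fun p : Fin r × Fin r => p.2 < p.1)).card := by
    refine Finset.card_nbij' Prod.swap Prod.swap ?_ ?_ ?_ ?_ <;> intro p <;> simp
  have h2 := Finset.offDiag_card (Finset.univ : Finset (Fin r))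
  have h3 : (Finset.univ : Finset (Fin r)).offDiag =
      (Finset.univ.filter (fun p : Fin r × Fin r => p.1 < p.2)) ∪
      (Finset.univ.filter (fun p : Fin r × Fin r => p.2 < p.1)) := by
    ext p; simp [lt_or_lt_iff_ne]
  rw [h3, Finset.card_union_of_disjoint, ← h1, ← two_mul] at h2
  · rw [h2]; simp [Nat.mul_sub]
  · rw [Finset.disjoint_filter]
    exact fun p _ h => h.not_gt

/-- `2 ^ n * n!` times the number of multisets of `n` two-element subsets of `Fin r`, as a product.
The value at `r = 0` is set to `0` also for `n = 0`, so that the case `n = 0` can start the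
induction in `one_sub_X_pow_mul_mk_pairWeight_eq_sum`. -/
def pairWeight (n r : ℕ) : ℤ :=
  if r = 0 then 0 else ∏ i ∈ Finset.range n, ((r : ℤ) * (r - 1) + 2 * i)

theorem pairWeight_succ (n r : ℕ) :
    pairWeight (n + 1) r = ((r : ℤ) * (r - 1) + 2 * n) * pairWeight n r := by
  unfold pairWeight
  split_ifs
  · simp
  · rw [Finset.prod_range_succ, mul_comm]

theorem two_pow_mul_factorial_mul_multichoose {n : ℕ} (hn : 0 < n) {e r : ℕ}
    (he : 2 * e = r * (r - 1)) :
    (2 ^ n * n.factorial * e.multichoose n : ℤ) = pairWeight n r := by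
  have he' : (2 * e : ℤ) = r * (r - 1) := by
    rcases r with _ | r
    · simp at he; simp [he]
    · have : ((2 * e : ℕ) : ℤ) = _ := congrArg _ he
      push_cast at this
      simpa using this
  have h1 : n.factorial * e.multichoose n = ∏ i ∈ Finset.range n, (e + i) := by
    rw [← Nat.ascFactorial_eq_prod_range, Nat.multichoose_eq,
      Nat.ascFactorial_eq_factorial_mul_choose']
  have h2 : (n.factorial * e.multichoose n : ℤ) = ∏ i ∈ Finset.range n, ((e : ℤ) + i) := by
    exact_mod_cast h1
  have h3 : (2 ^ n * n.factorial * e.multichoose n : ℤ) =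
      ∏ i ∈ Finset.range n, ((r : ℤ) * (r - 1) + 2 * i) := by
    rw [mul_assoc, h2, ← Finset.card_range n, ← Finset.prod_const, Finset.card_range,
      ← Finset.prod_mul_distrib]
    refine Finset.prod_congr rfl fun i _ => ?_
    rw [← he']; ring
  rw [h3, pairWeight]
  split_ifs with h
  · exact Finset.prod_eq_zero (Finset.mem_range.2 hn) (by simp [h])
  · rfl

/-- Both sides count the compatible words in the alphabet `Fin r` of all fixed-point-free
involutions of `2 n` points. -/
theorem sum_choose_descentNumber (m n r : ℕ) (hm : 2 * n = m + 1) :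
    ∑ π ∈ fixedPointFreeInvolutions (2 * n), (r + m - descentNumber π).choose (2 * n) =
      (Finset.univ.filter (fun p : Fin r × Fin r => p.1 < p.2)).card.multichoose n := by
  classical
  rw [← card_compatiblePairs, compatiblePairs, Finset.card_filter, Finset.sum_product]
  refine Finset.sum_congr rfl fun π _ => ?_
  rw [← Finset.card_filter]
  generalize 2 * n = k at *
  subst hm
  exact (card_isCompatible π r).symm

theorem descentNumber_lt {n : ℕ} (hn : 0 < n) (π : Equiv.Perm (Fin n)) : descentNumber π < n := by
  obtain ⟨m, rfl⟩ := Nat.exists_eq_add_one.2 hn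
  exact Nat.lt_succ_of_le (descentNumber_le π)

theorem one_sub_X_pow_mul_mk_choose {m d : ℕ} (hd : d ≤ m) :
    (1 - PowerSeries.X : PowerSeries ℤ) ^ (m + 2) *
      PowerSeries.mk (fun r => ((r + m - d).choose (m + 1) : ℤ)) = PowerSeries.X ^ (d + 1) := by
  have h : PowerSeries.mk (fun r => ((r + m - d).choose (m + 1) : ℤ)) =
      PowerSeries.X ^ (d + 1) * PowerSeries.mk fun s => ((m + 1 + s).choose (m + 1) : ℤ) := by
    ext r
    rw [PowerSeries.coeff_mk, PowerSeries.coeff_X_pow_mul']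
    split_ifs with hr
    · rw [PowerSeries.coeff_mk]
      congr 2
      omega
    · rw [Nat.choose_eq_zero_of_lt (by omega)]; rfl
  rw [h, mul_left_comm, mul_comm ((1 - PowerSeries.X : PowerSeries ℤ) ^ (m + 2)),
    PowerSeries.mk_add_choose_mul_one_sub_pow_eq_one, mul_one]

theorem one_sub_X_pow_mul_mk_pairWeight {n : ℕ} (hn : 0 < n) :
    (1 - PowerSeries.X : PowerSeries ℤ) ^ (2 * n + 1) * PowerSeries.mk (pairWeight n) =
      PowerSeries.X * ((C (2 ^ n * n.factorial : ℤ) * descentPolynomialJ (2 * n) : ℤ[X]) :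
        PowerSeries ℤ) := by
  obtain ⟨m, hm⟩ : ∃ m, 2 * n = m + 1 := Nat.exists_eq_add_one.2 (by omega)
  have h : PowerSeries.mk (pairWeight n) = PowerSeries.C (2 ^ n * n.factorial : ℤ) *
      ∑ π ∈ fixedPointFreeInvolutions (2 * n),
        PowerSeries.mk (fun r => ((r + m - descentNumber π).choose (2 * n) : ℤ)) := by
    ext r
    rw [PowerSeries.coeff_C_mul, map_sum]
    simp only [PowerSeries.coeff_mk]
    rw [← two_pow_mul_factorial_mul_multichoose hn (two_mul_card_filter_lt r),
      ← sum_choose_descentNumber m n r hm]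
    push_cast
    rfl
  rw [h, mul_left_comm, Finset.mul_sum, descentPolynomialJ, Polynomial.coe_mul, Polynomial.coe_C,
    mul_left_comm]
  congr 1
  rw [← Polynomial.coeToPowerSeries.ringHom_apply, map_sum, Finset.mul_sum]
  refine Finset.sum_congr rfl fun π _ => ?_
  have hd : descentNumber π ≤ m := by
    have := descentNumber_lt (by omega) π
    omega
  have h2 := one_sub_X_pow_mul_mk_choose hd
  rw [← hm, show m + 2 = 2 * n + 1 by omega] at h2
  rw [h2, map_pow, Polynomial.coeToPowerSeries.ringHom_apply, Polynomial.coe_X, pow_succ']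

/-! ### The recurrence for the γ-coefficients -/

/-- `2 ^ n * n!` times the coefficient of `t ^ k (1 + t) ^ (2 n - 2 k)` in `J_{2n}(t)`, defined by
its recurrence. Multiplying by `2 ^ n * n!` avoids division by `2 n + 2`. The value at `n = 0` is
the one that fits the recurrence. -/
def gammaNumerator : ℕ → ℕ → ℤ
  | 0, k => if k = 0 then 1 else 0
  | n + 1, 0 => 2 * n * gammaNumerator n 0
  | n + 1, 1 => (2 * n + 2) * gammaNumerator n 1 + 2 * gammaNumerator n 0
  | n + 1, k + 2 =>
    ((k + 2) * (k + 3) + 2 * n) * gammaNumerator n (k + 2) +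
      (2 + 2 * (k + 1) * (4 * (n - (k + 1)) - 3)) * gammaNumerator n (k + 1) +
      8 * (n - k) * (2 * (n - k) - 1) * gammaNumerator n k

theorem gammaNumerator_eq_zero_of_lt {n k : ℕ} (h : n < k) : gammaNumerator n k = 0 := by
  induction n generalizing k with
  | zero => simp [gammaNumerator]; omega
  | succ n ih =>
    obtain ⟨k, rfl⟩ : ∃ j, k = j + 2 := ⟨k - 2, by omega⟩
    rw [gammaNumerator, ih (by omega), ih (by omega)]
    rcases eq_or_ne n k with rfl | hk
    · simp
    · rw [ih (by omega)]; simp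

theorem gammaNumerator_zero_right {n : ℕ} (hn : 0 < n) : gammaNumerator n 0 = 0 := by
  obtain ⟨n, rfl⟩ := Nat.exists_eq_add_one.2 hn
  induction n with
  | zero => simp [gammaNumerator]
  | succ n ih => rw [gammaNumerator, ih (by omega), mul_zero]

theorem gammaNumerator_one_right {n : ℕ} (hn : 0 < n) :
    gammaNumerator n 1 = 2 ^ n * n.factorial := by
  obtain ⟨n, rfl⟩ := Nat.exists_eq_add_one.2 hn
  induction n with
  | zero => simp [gammaNumerator]
  | succ n ih =>
    rw [gammaNumerator, ih (by omega), gammaNumerator_zero_right (by omega),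
      Nat.factorial_succ (n + 1)]
    push_cast; ring

section Series
open scoped PowerSeries

theorem one_sub_X_pow_mul_derivative (q : ℕ) (F : ℤ⟦X⟧) :
    (1 - PowerSeries.X) ^ (q + 1) * d⁄dX ℤ F =
      (1 - PowerSeries.X) * d⁄dX ℤ ((1 - PowerSeries.X) ^ q * F) +
        (q : ℤ⟦X⟧) * ((1 - PowerSeries.X) ^ q * F) := by
  rw [Derivation.leibniz, smul_eq_mul, smul_eq_mul, PowerSeries.derivative_pow]
  rcases q with _ | q
  · simp
  · simp; ring

/-- The operator `F ↦ X² F'' + 2 n F` in terms of `P = (1 - X) ^ (2 n + 1) * F`, with the result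
multiplied by `(1 - X) ^ (2 n + 3)`. -/
noncomputable def seriesStep (n : ℕ) (P : ℤ⟦X⟧) : ℤ⟦X⟧ :=
  (1 - PowerSeries.X) ^ 2 * PowerSeries.X ^ 2 * d⁄dX ℤ (d⁄dX ℤ P) +
    2 * (2 * (n : ℤ⟦X⟧) + 1) * (1 - PowerSeries.X) * PowerSeries.X ^ 2 * d⁄dX ℤ P +
    ((2 * (n : ℤ⟦X⟧) + 1) * (2 * (n : ℤ⟦X⟧) + 2) * PowerSeries.X ^ 2 +
      2 * (n : ℤ⟦X⟧) * (1 - PowerSeries.X) ^ 2) * P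

theorem seriesStep_add (n : ℕ) (P Q : ℤ⟦X⟧) :
    seriesStep n (P + Q) = seriesStep n P + seriesStep n Q := by
  simp only [seriesStep, map_add]; ring

theorem seriesStep_C_mul (n : ℕ) (c : ℤ) (P : ℤ⟦X⟧) :
    seriesStep n (PowerSeries.C c * P) = PowerSeries.C c * seriesStep n P := by
  simp only [seriesStep, Derivation.leibniz, smul_eq_mul, PowerSeries.derivative_C, mul_zero,
    add_zero]
  ring

theorem mk_pairWeight_succ (n : ℕ) :
    PowerSeries.mk (pairWeight (n + 1)) =
      PowerSeries.X ^ 2 * d⁄dX ℤ (d⁄dX ℤ (PowerSeries.mk (pairWeight n))) +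
        2 * (n : ℤ⟦X⟧) * PowerSeries.mk (pairWeight n) := by
  have h : (2 * (n : ℤ⟦X⟧)) = PowerSeries.C (2 * n : ℤ) := by simp
  ext r
  rw [PowerSeries.coeff_mk, pairWeight_succ, map_add, PowerSeries.coeff_X_pow_mul', h,
    PowerSeries.coeff_C_mul]
  split_ifs with hr
  · obtain ⟨r, rfl⟩ := Nat.exists_eq_add_of_le' hr
    simp only [Nat.add_sub_cancel, PowerSeries.coeff_derivative, PowerSeries.coeff_mk]
    push_cast
    ring
  · rw [PowerSeries.coeff_mk]
    have : r = 0 ∨ r = 1 := by omega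
    rcases this with rfl | rfl <;> simp

theorem one_sub_X_pow_mul_mk_pairWeight_succ (n : ℕ) :
    (1 - PowerSeries.X) ^ (2 * (n + 1) + 1) * PowerSeries.mk (pairWeight (n + 1)) =
      seriesStep n ((1 - PowerSeries.X) ^ (2 * n + 1) * PowerSeries.mk (pairWeight n)) := by
  rw [mk_pairWeight_succ]
  set F := PowerSeries.mk (pairWeight n)
  have h1 := one_sub_X_pow_mul_derivative (2 * n + 1) F
  have h2 := one_sub_X_pow_mul_derivative (2 * n + 2) (d⁄dX ℤ F)
  set P := (1 - PowerSeries.X) ^ (2 * n + 1) * F with hP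
  rw [show 2 * n + 2 = 2 * n + 1 + 1 from rfl, h1, map_add,
    Derivation.leibniz _ (1 - PowerSeries.X) (d⁄dX ℤ P), Derivation.leibniz _ _ P] at h2
  have h3 : d⁄dX ℤ ((2 * n + 1 : ℕ) : ℤ⟦X⟧) = 0 := Derivation.map_natCast _ _
  have h4 : d⁄dX ℤ (1 - PowerSeries.X : ℤ⟦X⟧) = -1 := by simp
  rw [h3, h4] at h2
  simp only [smul_eq_mul] at h2
  have h5 : (1 - PowerSeries.X) ^ (2 * (n + 1) + 1) *
        (PowerSeries.X ^ 2 * d⁄dX ℤ (d⁄dX ℤ F) + 2 * (n : ℤ⟦X⟧) * F) =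
      PowerSeries.X ^ 2 * ((1 - PowerSeries.X) ^ (2 * n + 1 + 1 + 1) * d⁄dX ℤ (d⁄dX ℤ F)) +
        2 * (n : ℤ⟦X⟧) * (1 - PowerSeries.X) ^ 2 * P := by
    rw [hP]; ring
  rw [h5, h2, seriesStep]
  push_cast
  ring

/-- The operator maps the `k`-th basis element for `n = k + m` to a combination of the `k`-th,
`k + 1`-st and `k + 2`-nd basis elements for `n + 1`. For `m = 0` the exponent `2 * (m - 1)` is
truncated, but then the last coefficient vanishes. -/
theorem seriesStep_basis (k m : ℕ) :
    seriesStep (k + m) (PowerSeries.X * (PowerSeries.X ^ k * (1 + PowerSeries.X) ^ (2 * m))) =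
      PowerSeries.X * (PowerSeries.C (k * (k + 1) + 2 * (k + m) : ℤ) *
          (PowerSeries.X ^ k * (1 + PowerSeries.X) ^ (2 * (m + 1))) +
        PowerSeries.C (2 + 2 * k * (4 * m - 3) : ℤ) *
          (PowerSeries.X ^ (k + 1) * (1 + PowerSeries.X) ^ (2 * m)) +
        PowerSeries.C (8 * m * (2 * m - 1) : ℤ) *
          (PowerSeries.X ^ (k + 2) * (1 + PowerSeries.X) ^ (2 * (m - 1)))) := by
  have h0 : PowerSeries.X * (PowerSeries.X ^ k * (1 + PowerSeries.X) ^ (2 * m)) =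
      (PowerSeries.X ^ (k + 1) * (1 + PowerSeries.X) ^ (2 * m) : ℤ⟦X⟧) := by
    ring
  rw [h0, seriesStep]
  have hC : ∀ z : ℤ, PowerSeries.C z = (z : ℤ⟦X⟧) := fun z => by simp
  have hD : ∀ j l : ℕ, d⁄dX ℤ (PowerSeries.X ^ j * (1 + PowerSeries.X) ^ l : ℤ⟦X⟧) =
      (l : ℤ⟦X⟧) * (PowerSeries.X ^ j * (1 + PowerSeries.X) ^ (l - 1)) +
        (j : ℤ⟦X⟧) * (PowerSeries.X ^ (j - 1) * (1 + PowerSeries.X) ^ l) := by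
    intro j l
    simp [Derivation.leibniz]; ring
  have hn : ∀ j : ℕ, d⁄dX ℤ (j : ℤ⟦X⟧) = 0 := fun j => Derivation.map_natCast _ _
  simp only [hD, map_add, Derivation.leibniz, hn, smul_eq_mul, mul_zero, add_zero, hC]
  rcases m with _ | m
  · rcases k with _ | k
    · simp; ring
    · simp; ring
  · rcases k with _ | k
    · simp [mul_add]; ring
    · simp [mul_add]; ring

theorem one_sub_X_pow_mul_mk_pairWeight_eq_sum (n : ℕ) :
    (1 - PowerSeries.X) ^ (2 * n + 1) * PowerSeries.mk (pairWeight n) =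
      PowerSeries.X * ∑ k ∈ Finset.range (n + 1),
        PowerSeries.C (gammaNumerator n k) *
          (PowerSeries.X ^ k * (1 + PowerSeries.X) ^ (2 * (n - k))) := by
  induction n with
  | zero =>
    have h : PowerSeries.mk (pairWeight 0) = (PowerSeries.X * PowerSeries.mk 1 : ℤ⟦X⟧) := by
      ext r
      rcases r with _ | r
      · simp [pairWeight]
      · simp [pairWeight, PowerSeries.coeff_succ_X_mul]
    rw [h, mul_left_comm]
    simp [gammaNumerator, mul_comm _ (PowerSeries.mk 1), PowerSeries.mk_one_mul_one_sub_eq_one]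
  | succ n ih =>
    rw [one_sub_X_pow_mul_mk_pairWeight_succ, ih, Finset.mul_sum]
    have hsum : ∀ (s : Finset ℕ) (f : ℕ → ℤ⟦X⟧),
        seriesStep n (∑ k ∈ s, f k) = ∑ k ∈ s, seriesStep n (f k) := by
      intro s f
      refine map_sum (AddMonoidHom.mk' (seriesStep n) (seriesStep_add n)) f s
    rw [hsum]
    let E : ℕ → ℤ⟦X⟧ := fun j => PowerSeries.X ^ j * (1 + PowerSeries.X) ^ (2 * (n + 1 - j))
    have hterm : ∀ k ∈ Finset.range (n + 1),
        seriesStep n (PowerSeries.X * (PowerSeries.C (gammaNumerator n k) *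
          (PowerSeries.X ^ k * (1 + PowerSeries.X) ^ (2 * (n - k))))) =
        PowerSeries.X * (PowerSeries.C ((k * (k + 1) + 2 * n) * gammaNumerator n k) * E k +
          PowerSeries.C ((2 + 2 * k * (4 * (n - k) - 3)) * gammaNumerator n k) * E (k + 1) +
          PowerSeries.C (8 * (n - k) * (2 * (n - k) - 1) * gammaNumerator n k) * E (k + 2)) := by
      intro k hk
      obtain ⟨m, rfl⟩ := Nat.exists_eq_add_of_le (Nat.lt_succ_iff.1 (Finset.mem_range.1 hk))
      rw [mul_left_comm, seriesStep_C_mul, Nat.add_sub_cancel_left, seriesStep_basis]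
      simp only [E, show k + m + 1 - k = m + 1 by omega, show k + m + 1 - (k + 1) = m by omega,
        show k + m + 1 - (k + 2) = m - 1 by omega, map_mul]
      push_cast
      rw [show (k + m - k : ℤ) = m by ring]
      ring
    rw [Finset.sum_congr rfl hterm, ← Finset.mul_sum]
    congr 1
    rw [Finset.sum_add_distrib, Finset.sum_add_distrib]
    -- The three sums contribute to the indices `k`, `k + 1` and `k + 2`. Since the first has a zero
    -- term at `n + 1` and the last at `n`, all of them can be taken over the indices up to `n + 1`.
    have hA := Finset.sum_range_succ (fun k : ℕ =>
      PowerSeries.C ((k * (k + 1) + 2 * n) * gammaNumerator n k) * E k) (n + 1)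
    have hC := Finset.sum_range_succ (fun k : ℕ =>
      PowerSeries.C (8 * (n - k) * (2 * (n - k) - 1) * gammaNumerator n k) * E (k + 2)) n
    rw [gammaNumerator_eq_zero_of_lt (Nat.lt_succ_self n), mul_zero, map_zero, zero_mul,
      add_zero] at hA
    rw [sub_self, mul_zero, zero_mul, zero_mul, map_zero, zero_mul, add_zero] at hC
    rw [← hA, hC, Finset.sum_range_succ', Finset.sum_range_succ', Finset.sum_range_succ',
      Finset.sum_range_succ' _ (n + 1), Finset.sum_range_succ' _ n]
    have hrec : ∀ k ∈ Finset.range n, PowerSeries.C (gammaNumerator (n + 1) (k + 1 + 1)) *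
        E (k + 1 + 1) =
        PowerSeries.C ((((k + 1 + 1 : ℕ) : ℤ) * ((k + 1 + 1 : ℕ) + 1) + 2 * n) *
          gammaNumerator n (k + 1 + 1)) * E (k + 1 + 1) +
        PowerSeries.C ((2 + 2 * ((k + 1 : ℕ) : ℤ) * (4 * (n - (k + 1 : ℕ)) - 3)) *
          gammaNumerator n (k + 1)) * E (k + 1 + 1) +
        PowerSeries.C (8 * (n - k) * (2 * (n - k) - 1) * gammaNumerator n k) * E (k + 2) := by
      intro k _
      rw [gammaNumerator, ← add_mul, ← add_mul, ← map_add, ← map_add]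
      push_cast
      ring_nf
    have h0 : PowerSeries.C (gammaNumerator (n + 1) 0) * E 0 =
        PowerSeries.C ((((0 : ℕ) : ℤ) * ((0 : ℕ) + 1) + 2 * n) * gammaNumerator n 0) * E 0 := by
      simp [gammaNumerator]
    have h1 : PowerSeries.C (gammaNumerator (n + 1) (0 + 1)) * E (0 + 1) =
        PowerSeries.C ((((0 + 1 : ℕ) : ℤ) * ((0 + 1 : ℕ) + 1) + 2 * n) *
          gammaNumerator n (0 + 1)) * E (0 + 1) +
        PowerSeries.C ((2 + 2 * ((0 : ℕ) : ℤ) * (4 * (n - (0 : ℕ)) - 3)) *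
          gammaNumerator n 0) * E (0 + 1) := by
      rw [← add_mul, ← map_add, gammaNumerator]
      push_cast
      ring_nf
    change _ = ∑ k ∈ Finset.range n, PowerSeries.C (gammaNumerator (n + 1) (k + 1 + 1)) *
        E (k + 1 + 1) + PowerSeries.C (gammaNumerator (n + 1) (0 + 1)) * E (0 + 1) +
        PowerSeries.C (gammaNumerator (n + 1) 0) * E 0
    rw [Finset.sum_congr rfl hrec, h0, h1, Finset.sum_add_distrib, Finset.sum_add_distrib]
    clear_value E
    abel

end Series

/-! ### Nonnegativity of the γ-coefficients -/

theorem gammaNumerator_top (n : ℕ) :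
    gammaNumerator (n + 2) (n + 2) =
      (2 - 6 * (n + 1)) * gammaNumerator (n + 1) (n + 1) + 8 * gammaNumerator (n + 1) n := by
  rw [gammaNumerator, gammaNumerator_eq_zero_of_lt (by omega)]
  push_cast
  ring

/-- The two ratio inequalities between the three topmost numbers make the top number of the next
row nonnegative and reproduce themselves there. For `n = 9` the first of them fails. -/
theorem gammaNumerator_nonneg_of_ratio (n : ℕ) :
    (∀ k, 0 ≤ gammaNumerator (n + 10) k) ∧
      (n + 10) * gammaNumerator (n + 10) (n + 10) ≤ gammaNumerator (n + 10) (n + 9) ∧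
      3 * (n + 10) * gammaNumerator (n + 10) (n + 9) ≤ 20 * gammaNumerator (n + 10) (n + 8) := by
  induction n with
  | zero =>
    refine ⟨fun k => ?_, by decide +kernel, by decide +kernel⟩
    rcases lt_or_ge 10 k with hk | hk
    · rw [gammaNumerator_eq_zero_of_lt (by omega)]
    · have : ∀ k ≤ 10, 0 ≤ gammaNumerator 10 k := by decide +kernel
      simpa using this k hk
  | succ n ih =>
    obtain ⟨h0, h1, h2⟩ := ih
    have ex := gammaNumerator_top (n + 9)
    have ey : gammaNumerator (n + 11) (n + 10) =
        ((n + 10) * (n + 13)) * gammaNumerator (n + 10) (n + 10) +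
          (2 * (n + 10)) * gammaNumerator (n + 10) (n + 9) +
          48 * gammaNumerator (n + 10) (n + 8) := by
      rw [gammaNumerator]; push_cast; ring
    have ez : gammaNumerator (n + 11) (n + 9) =
        ((n + 10) * (n + 11)) * gammaNumerator (n + 10) (n + 9) +
          (10 * n + 82) * gammaNumerator (n + 10) (n + 8) +
          120 * gammaNumerator (n + 10) (n + 7) := by
      rw [gammaNumerator]; push_cast; ring
    have hn : (0 : ℤ) ≤ n := Int.natCast_nonneg n
    have hx := h0 (n + 10)
    have hy := h0 (n + 9)
    have hz := h0 (n + 8)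
    have hw := h0 (n + 7)
    rw [show n + 1 + 10 = n + 11 by omega, show n + 1 + 9 = n + 10 by omega,
      show n + 1 + 8 = n + 9 by omega]
    simp only [show n + 9 + 2 = n + 11 by omega, show n + 9 + 1 = n + 10 by omega] at ex
    push_cast at ex ⊢
    refine ⟨fun k => ?_, ?_, ?_⟩
    · rcases k with _ | _ | k
      · rw [gammaNumerator_zero_right (by omega)]
      · rw [gammaNumerator_one_right (by omega)]; positivity
      · rcases lt_trichotomy k (n + 9) with hk | rfl | hk
        · rw [gammaNumerator]
          have hk' : (k : ℤ) + 1 ≤ n + 9 := by exact_mod_cast hk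
          have e1 := h0 k
          have e2 := h0 (k + 1)
          have e3 := h0 (k + 2)
          have c2 : (0 : ℤ) ≤ 2 + 2 * (k + 1) * (4 * (((n + 10 : ℕ) : ℤ) - (k + 1)) - 3) := by
            have : (0 : ℤ) ≤ 4 * (((n + 10 : ℕ) : ℤ) - (k + 1)) - 3 := by push_cast; linarith
            positivity
          have c1 : (0 : ℤ) ≤ 8 * (((n + 10 : ℕ) : ℤ) - k) *
              (2 * (((n + 10 : ℕ) : ℤ) - k) - 1) := by
            refine mul_nonneg ?_ ?_ <;> push_cast <;> linarith
          positivity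
        · change 0 ≤ gammaNumerator (n + 11) (n + 11)
          rw [ex]
          nlinarith
        · rw [gammaNumerator_eq_zero_of_lt (by omega)]
    · rw [ex, ey]
      have hnx := mul_nonneg hn hx
      have hnnx := mul_nonneg hn hnx
      have hny := mul_nonneg hn hy
      linarith
    · rw [ey, ez]
      have hny := mul_nonneg hn hy
      have hnny := mul_nonneg hn hny
      have hnz := mul_nonneg hn hz
      have h1' := mul_nonneg (show (0 : ℤ) ≤ (n + 11) * (n + 13) by positivity) (sub_nonneg.2 h1)
      linarith

theorem gammaNumerator_nonneg {n : ℕ} (hn : 9 ≤ n) (k : ℕ) : 0 ≤ gammaNumerator n k := by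
  rcases hn.eq_or_lt with rfl | hn
  · rcases lt_or_ge 9 k with hk | hk
    · rw [gammaNumerator_eq_zero_of_lt hk]
    · have : ∀ k ≤ 9, 0 ≤ gammaNumerator 9 k := by decide +kernel
      exact this k hk
  · obtain ⟨j, rfl⟩ := Nat.exists_eq_add_of_le' (show 10 ≤ n from hn)
    exact (gammaNumerator_nonneg_of_ratio j).1 k

/-! ### γ-expansions -/

/-- The polynomial with coefficients `b 0, …, b n` in the basis `X ^ k (1 + X) ^ (2 n - 2 k)`. -/
noncomputable def gammaExpansion (n : ℕ) (b : ℕ → ℤ) : ℤ[X] :=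
  ∑ k ∈ Finset.range (n + 1), C (b k) * (X ^ k * (1 + X) ^ (2 * (n - k)))

theorem coeff_gammaExpansion (n : ℕ) (b : ℕ → ℤ) (j : ℕ) :
    (gammaExpansion n b).coeff j =
      ∑ k ∈ Finset.range (n + 1), b k *
        if k ≤ j then ((2 * (n - k)).choose (j - k) : ℤ) else 0 := by
  rw [gammaExpansion, finsetSum_coeff]
  refine Finset.sum_congr rfl fun k _ => ?_
  rw [coeff_C_mul, coeff_X_pow_mul', coeff_one_add_X_pow]

theorem coeff_gammaExpansion_symm (n : ℕ) (b : ℕ → ℤ) {j : ℕ} (hj : j ≤ 2 * n) :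
    (gammaExpansion n b).coeff (2 * n - j) = (gammaExpansion n b).coeff j := by
  rw [coeff_gammaExpansion, coeff_gammaExpansion]
  refine Finset.sum_congr rfl fun k hk => congrArg (b k * ·) ?_
  have hk' := Finset.mem_range.1 hk
  by_cases h1 : k ≤ j
  · by_cases h2 : k ≤ 2 * n - j
    · rw [if_pos h1, if_pos h2, ← Nat.choose_symm (show j - k ≤ 2 * (n - k) by omega)]
      congr 2
      omega
    · rw [if_pos h1, if_neg h2, Nat.choose_eq_zero_of_lt (by omega)]
      rfl
  · rw [if_neg h1]
    split_ifs with h2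
    · rw [Nat.choose_eq_zero_of_lt (by omega)]
      rfl
    · rfl

/-- The basis element with index `k` has lowest term `X ^ k`, so its coefficient is obtained from
the `k`-th coefficient of the polynomial and the `b j` with `j < k` by integer operations. -/
theorem dvd_of_dvd_coeff_gammaExpansion {n : ℕ} {b : ℕ → ℤ} {d : ℤ}
    (h : ∀ j, d ∣ (gammaExpansion n b).coeff j) {k : ℕ} (hk : k ≤ n) : d ∣ b k := by
  induction k using Nat.strong_induction_on with
  | _ k ih =>
    have hk' := h k
    rw [coeff_gammaExpansion, ← Finset.add_sum_erase _ _
      (Finset.mem_range.2 (Nat.lt_succ_of_le hk))] at hk'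
    simp only [le_refl, if_true, Nat.sub_self, Nat.choose_zero_right, Nat.cast_one, mul_one] at hk'
    refine (dvd_add_left (Finset.dvd_sum fun j hj => ?_)).1 hk'
    rw [Finset.mem_erase] at hj
    split_ifs with hjk
    · exact (ih j (lt_of_le_of_ne hjk hj.1) (by omega)).mul_right _
    · simp

theorem C_mul_descentPolynomialJ {n : ℕ} (hn : 0 < n) :
    C (2 ^ n * n.factorial : ℤ) * descentPolynomialJ (2 * n) =
      gammaExpansion n (gammaNumerator n) := by
  apply Polynomial.coe_injective ℤ
  have h := (one_sub_X_pow_mul_mk_pairWeight hn).symm.trans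
    (one_sub_X_pow_mul_mk_pairWeight_eq_sum n)
  rw [mul_left_cancel₀ PowerSeries.X_ne_zero h]
  simp only [gammaExpansion, ← Polynomial.coeToPowerSeries.ringHom_apply, map_sum, map_mul, map_pow,
    map_add, map_one]
  simp [Polynomial.coeToPowerSeries.ringHom_apply]

theorem exists_descentPolynomialJ_eq_gammaExpansion {n : ℕ} (hn : 0 < n) :
    ∃ b : ℕ → ℤ, descentPolynomialJ (2 * n) = gammaExpansion n b ∧
      ∀ k, gammaNumerator n k = (2 ^ n * n.factorial) * b k := by
  have hd : (2 ^ n * n.factorial : ℤ) ≠ 0 := by positivity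
  have hdvd : ∀ k, (2 ^ n * n.factorial : ℤ) ∣ gammaNumerator n k := by
    intro k
    rcases lt_or_ge n k with hk | hk
    · rw [gammaNumerator_eq_zero_of_lt hk]; exact dvd_zero _
    · refine dvd_of_dvd_coeff_gammaExpansion (fun j => ?_) hk
      rw [← C_mul_descentPolynomialJ hn, coeff_C_mul]
      exact dvd_mul_right _ _
  choose b hb using hdvd
  refine ⟨b, ?_, hb⟩
  apply mul_left_cancel₀ (C_ne_zero.2 hd)
  rw [C_mul_descentPolynomialJ hn, gammaExpansion, gammaExpansion, Finset.mul_sum]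
  refine Finset.sum_congr rfl fun k _ => ?_
  rw [hb, C_mul, mul_assoc]

theorem natDegree_descentPolynomialJ_lt {n : ℕ} (hn : 0 < n) :
    (descentPolynomialJ n).natDegree < n := by
  refine lt_of_le_of_lt (natDegree_sum_le_of_forall_le _ _ fun π _ => ?_) (Nat.sub_one_lt hn.ne')
  rw [natDegree_X_pow]
  exact Nat.le_sub_one_of_lt (descentNumber_lt hn π)

/-! ### γ-positivity -/

theorem theorem2 (n : ℕ) (hn : 9 ≤ n) :
    IsGammaPositive (descentPolynomialJ (2 * n)) (2 * n) ∧
      ∃ b : ℕ → ℤ,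
        descentPolynomialJ (2 * n) =
          ∑ k ∈ Finset.Icc 1 n, C (b k) * X ^ k * (1 + X) ^ (2 * n - 2 * k) ∧
        ∀ k ∈ Finset.Icc 1 n, 0 ≤ b k := by
  have hn0 : 0 < n := by omega
  obtain ⟨b, hJ, hb⟩ := exists_descentPolynomialJ_eq_gammaExpansion hn0
  have hd : (0 : ℤ) < 2 ^ n * n.factorial := by positivity
  have hb0 : b 0 = 0 := by
    have := hb 0
    rw [gammaNumerator_zero_right hn0] at this
    exact (mul_eq_zero.1 this.symm).resolve_left hd.ne'
  have hb1 : b 1 = 1 := by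
    have := hb 1
    rw [gammaNumerator_one_right hn0] at this
    exact (mul_eq_left₀ hd.ne').1 this.symm
  have hpos : ∀ k, 0 ≤ b k := by
    intro k
    have := gammaNumerator_nonneg hn k
    rw [hb] at this
    exact nonneg_of_mul_nonneg_right this hd
  have hsum : descentPolynomialJ (2 * n) =
      ∑ k ∈ Finset.Icc 1 n, C (b k) * X ^ k * (1 + X) ^ (2 * n - 2 * k) := by
    rw [hJ, gammaExpansion, Finset.range_eq_Ico, Finset.sum_eq_sum_Ico_succ_bot (by omega), hb0]
    rw [C_0, zero_mul, zero_add]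
    refine Finset.sum_congr rfl fun k _ => ?_
    rw [mul_assoc, Nat.mul_sub]
  have hc0 : (descentPolynomialJ (2 * n)).coeff 0 = 0 := by
    rw [hJ, coeff_gammaExpansion]
    refine Finset.sum_eq_zero fun k _ => ?_
    rcases k with _ | k
    · simp [hb0]
    · simp
  have hc1 : (descentPolynomialJ (2 * n)).coeff 1 = 1 := by
    rw [hJ, coeff_gammaExpansion, Finset.sum_eq_single 1]
    · simp [hb1]
    · intro k _ hk
      rcases k with _ | k
      · simp [hb0]
      · rw [if_neg (by omega), mul_zero]
    · intro h; simp at h; omega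
  have hsymm : ∀ j ≤ 2 * n, (descentPolynomialJ (2 * n)).coeff (2 * n - j) =
      (descentPolynomialJ (2 * n)).coeff j := by
    intro j hj
    rw [hJ, coeff_gammaExpansion_symm n b hj]
  have htrail : (descentPolynomialJ (2 * n)).natTrailingDegree = 1 := by
    refine le_antisymm (natTrailingDegree_le_of_ne_zero (by simp [hc1])) ?_
    rw [Nat.one_le_iff_ne_zero, Ne, natTrailingDegree_eq_zero, not_or]
    exact ⟨fun h => by simp [h] at hc1, by simp [hc0]⟩
  have hdeg : (descentPolynomialJ (2 * n)).natDegree = 2 * n - 1 := by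
    refine le_antisymm (Nat.le_sub_one_of_lt (natDegree_descentPolynomialJ_lt (by omega)))
      (le_natDegree_of_ne_zero ?_)
    rw [hsymm 1 (by omega), hc1]
    exact one_ne_zero
  refine ⟨⟨⟨?_, fun i hi => ?_⟩, b, ?_, fun k _ => hpos k⟩, b, hsum, fun k _ => hpos k⟩
  · omega
  · rw [htrail] at hi ⊢
    rw [hdeg, ← hsymm (1 + i) (by omega)]
    congr 1
    omega
  · rw [htrail, Nat.mul_div_cancel_left n two_pos]
    exact hsum
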